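/- Call two maps $f, g : \mathbb{C} \to \mathbb{C}$ topologically conjugate if there is a homeomorphism $h : \mathbb{C} \to \mathbb{C}$ such that $g = h \circ f \circ h^{-1}$. Let $a, b, c, d \in \mathbb{C}$, and let $f(z) = az + b$ and $g(z) = cz + d$ be affine maps of $\mathbb{C}$. Then $f$ and $g$ are topologically conjugate if and only if both of the following conditions hold: 1. at least one of the following is true: ($0 < |a| < 1$ and $0 < |c| < 1$), or ($|a| > 1$ and $|c| > 1$), or $a = c$, or $a = \bar{c}$; 2. if $a = c = 1$, then $b$ and $d$ are either both zero or both nonzero. -/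

import Mathlib

/-- Two self-maps `f` and `g` of a topological space `X` are topologically conjugate if
`g = h ∘ f ∘ h⁻¹` for some homeomorphism `h` of `X` onto itself. -/
def TopologicallyConjugate {X : Type*} [TopologicalSpace X] (f g : X → X) : Prop :=
  ∃ h : X ≃ₜ X, g = h ∘ f ∘ h.symm

open Complex Filter Topology

namespace TopologicallyConjugate

variable {X : Type*} [TopologicalSpace X] {f g k : X → X}

/-! If `a ≠ 1`, moving the fixed point to 0 makes the map linear; translations are told apart by
their fixed points. Linear maps on the same side of the unit circle are conjugated by `radialTwist`,
and conjugate multipliers by complex conjugation. Conversely, a conjugacy `h` of linear maps fixing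
0 preserves convergence of orbits to 0, which separates `|a| < 1`, `|a| = 1` and `|a| > 1`. On the
circle, `h` lifts through `exp` to a map of degree `n = ±1`. The rotation lifts to a translation,
and boundedness of a periodic function gives `c = a ^ n` (`translation_constants_proportional`). -/

theorem of_semiconj (h : X ≃ₜ X) (hfg : ∀ x, h (f x) = g (h x)) : TopologicallyConjugate f g :=
  ⟨h, funext fun x => by simp [hfg]⟩

theorem exists_semiconj (H : TopologicallyConjugate f g) :
    ∃ h : X ≃ₜ X, ∀ x, h (f x) = g (h x) := by
  obtain ⟨h, rfl⟩ := H
  exact ⟨h, fun x => by simp⟩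

theorem refl (f : X → X) : TopologicallyConjugate f f :=
  of_semiconj (Homeomorph.refl X) fun _ => rfl

theorem symm (H : TopologicallyConjugate f g) : TopologicallyConjugate g f := by
  obtain ⟨h, hh⟩ := H.exists_semiconj
  exact of_semiconj h.symm fun x => h.injective (by simp [hh])

theorem trans (H : TopologicallyConjugate f g) (K : TopologicallyConjugate g k) :
    TopologicallyConjugate f k := by
  obtain ⟨h, hh⟩ := H.exists_semiconj
  obtain ⟨l, hl⟩ := K.exists_semiconj
  exact of_semiconj (h.trans l) fun x => by simp [hh, hl]

end TopologicallyConjugate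

/-- An affine map with linear part `a ≠ 1` is conjugate to its linear part by a translation. -/
theorem topologicallyConjugate_affine_linear {a : ℂ} (ha : a ≠ 1) (b : ℂ) :
    TopologicallyConjugate (fun z : ℂ => a * z + b) (fun z : ℂ => a * z) := by
  have h1 : a - 1 ≠ 0 := sub_ne_zero.mpr ha
  refine .of_semiconj (Homeomorph.addRight (b / (a - 1))) fun z => ?_
  simp only [Homeomorph.coe_addRight]
  field_simp
  ring

/-! ### The radial twists `z ↦ z * |z| ^ w` -/

/-- The map `z ↦ z * |z| ^ w`. -/
noncomputable def radialTwist (w z : ℂ) : ℂ := z * (‖z‖ : ℂ) ^ w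

theorem radialTwist_zero_right (w : ℂ) : radialTwist w 0 = 0 := by simp [radialTwist]

theorem norm_radialTwist {w : ℂ} (hw : 0 < 1 + w.re) (z : ℂ) :
    ‖radialTwist w z‖ = ‖z‖ ^ (1 + w.re) := by
  rcases eq_or_ne z 0 with rfl | hz
  · simp [radialTwist, Real.zero_rpow hw.ne']
  · have hz' : 0 < ‖z‖ := norm_pos_iff.mpr hz
    rw [radialTwist, norm_mul, norm_cpow_eq_rpow_re_of_pos hz', Real.rpow_add hz', Real.rpow_one]

theorem continuous_radialTwist {w : ℂ} (hw : 0 < 1 + w.re) : Continuous (radialTwist w) := by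
  refine continuous_iff_continuousAt.mpr fun z => ?_
  rcases eq_or_ne z 0 with rfl | hz
  · rw [ContinuousAt, radialTwist_zero_right, tendsto_zero_iff_norm_tendsto_zero]
    have h : Continuous fun z : ℂ => ‖z‖ ^ (1 + w.re) :=
      continuous_norm.rpow_const fun _ => Or.inr hw.le
    simpa [norm_radialTwist hw, Real.zero_rpow hw.ne'] using h.tendsto 0
  · have h := continuousAt_ofReal_cpow_const ‖z‖ w (Or.inr (norm_ne_zero_iff.mpr hz))
    exact continuousAt_id.mul (ContinuousAt.comp (f := fun z : ℂ => ‖z‖) h continuous_norm.continuousAt)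

/-- In the coordinate `ζ = log z` the twist is `ζ ↦ ζ + w * Re ζ`; `hv` says that two such
real-linear maps compose to the identity. -/
theorem radialTwist_comp {w v : ℂ} (hw : 0 < 1 + w.re) (hv : w + v + w.re * v = 0) (z : ℂ) :
    radialTwist v (radialTwist w z) = z := by
  rcases eq_or_ne z 0 with rfl | hz
  · simp [radialTwist_zero_right]
  · have hz' : 0 < ‖z‖ := norm_pos_iff.mpr hz
    have h0 : (‖z‖ : ℂ) ≠ 0 := ofReal_ne_zero.mpr hz'.ne'
    have hr : (‖z‖ ^ (1 + w.re) : ℝ) ≠ 0 := (Real.rpow_pos_of_pos hz' _).ne'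
    rw [radialTwist, norm_radialTwist hw, radialTwist, mul_assoc, cpow_def_of_ne_zero h0,
      cpow_def_of_ne_zero (ofReal_ne_zero.mpr hr), ← Complex.exp_add, ← ofReal_log hz'.le,
      ← ofReal_log (Real.rpow_nonneg hz'.le _), Real.log_rpow hz', ofReal_mul]
    have : (Real.log ‖z‖ : ℂ) * w + ((1 + w.re : ℝ) : ℂ) * Real.log ‖z‖ * v = 0 := by
      push_cast
      linear_combination (Real.log ‖z‖ : ℂ) * hv
    rw [this, Complex.exp_zero, mul_one]

/-- For `Re w > -1`, the radial twist by `w` as a homeomorphism of the plane. -/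
noncomputable def radialTwistHomeomorph (w : ℂ) (hw : 0 < 1 + w.re) : ℂ ≃ₜ ℂ :=
  have hc : (1 + w.re : ℂ) ≠ 0 := by exact_mod_cast hw.ne'
  have hre : (-w / (1 + w.re : ℂ)).re = -w.re / (1 + w.re) := by
    have h := div_ofReal_re (-w) (1 + w.re)
    push_cast at h
    simpa using h
  have hv : 0 < 1 + (-w / (1 + w.re : ℂ)).re := by
    rw [hre]
    have : 1 + -w.re / (1 + w.re) = 1 / (1 + w.re) := by field_simp; ring
    rw [this]
    positivity
  { toFun := radialTwist w
    invFun := radialTwist (-w / (1 + w.re))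
    left_inv := radialTwist_comp hw (by field_simp; ring)
    right_inv := radialTwist_comp hv (by
      rw [hre]
      push_cast
      field_simp
      ring)
    continuous_toFun := continuous_radialTwist hw
    continuous_invFun := continuous_radialTwist hv }

theorem radialTwist_mul (w a z : ℂ) :
    radialTwist w (a * z) = a * (‖a‖ : ℂ) ^ w * radialTwist w z := by
  rw [radialTwist, radialTwist, norm_mul, ofReal_mul,
    mul_cpow_ofReal_nonneg (norm_nonneg a) (norm_nonneg z)]
  ring

/-- Two linear maps that both contract, or both expand, are conjugate. -/
theorem topologicallyConjugate_linear_of_log_mul_pos {a c : ℂ}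
    (h : 0 < Real.log ‖a‖ * Real.log ‖c‖) :
    TopologicallyConjugate (fun z : ℂ => a * z) (fun z : ℂ => c * z) := by
  have hla : Real.log ‖a‖ ≠ 0 := fun h0 => by simp [h0] at h
  have hlc : Real.log ‖c‖ ≠ 0 := fun h0 => by simp [h0] at h
  have ha : a ≠ 0 := fun h0 => by simp [h0] at hla
  have hc : c ≠ 0 := fun h0 => by simp [h0] at hlc
  have hla' : (Real.log ‖a‖ : ℂ) ≠ 0 := ofReal_ne_zero.mpr hla
  -- This solves `a * |a| ^ w = c`, and `1 + Re w = log |c| / log |a|` is positive.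
  set w : ℂ := (log c - log a) / (Real.log ‖a‖ : ℂ) with hw
  have hre : 1 + w.re = Real.log ‖a‖ * Real.log ‖c‖ / Real.log ‖a‖ ^ 2 := by
    rw [hw, div_ofReal_re, sub_re, log_re, log_re]
    field_simp
    ring
  have hpos : 0 < 1 + w.re := by rw [hre]; positivity
  refine .of_semiconj (radialTwistHomeomorph w hpos) fun z => ?_
  have hmul : a * (‖a‖ : ℂ) ^ w = c := by
    rw [cpow_def_of_ne_zero (ofReal_ne_zero.mpr (norm_ne_zero_iff.mpr ha)),
      ← ofReal_log (norm_nonneg a), hw, mul_div_cancel₀ _ hla', exp_sub, exp_log hc, exp_log ha]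
    field_simp
  change radialTwist w (a * z) = c * radialTwist w z
  rw [radialTwist_mul, hmul]

/-! ### Linear conjugacies outside the unit circle -/

theorem semiconj_linear_inv {a c : ℂ} (ha : a ≠ 0) (hc : c ≠ 0) {h : ℂ → ℂ}
    (hh : ∀ z, h (a * z) = c * h z) (z : ℂ) : h (a⁻¹ * z) = c⁻¹ * h z := by
  rw [eq_inv_mul_iff_mul_eq₀ hc, ← hh, mul_inv_cancel_left₀ ha]

theorem semiconj_linear_pow {a c : ℂ} {h : ℂ → ℂ} (hh : ∀ z, h (a * z) = c * h z) (z : ℂ) (n : ℕ) :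
    h (a ^ n * z) = c ^ n * h z := by
  induction n with
  | zero => simp
  | succ n ih => rw [pow_succ', mul_assoc, hh, ih, pow_succ', mul_assoc]

/-- The orbit of `h.symm 1` tends to 0, and `h` carries it to the powers of `c`. -/
theorem norm_lt_one_of_semiconj_linear {a c : ℂ} (h : ℂ ≃ₜ ℂ) (h0 : h 0 = 0)
    (hh : ∀ z, h (a * z) = c * h z) (ha : ‖a‖ < 1) : ‖c‖ < 1 := by
  rw [← tendsto_pow_atTop_nhds_zero_iff_norm_lt_one]
  have h1 : Tendsto (fun n : ℕ => a ^ n * h.symm 1) atTop (𝓝 0) := by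
    simpa using (tendsto_pow_atTop_nhds_zero_of_norm_lt_one ha).mul_const (h.symm 1)
  have h2 := (h.continuous.tendsto 0).comp h1
  rw [h0] at h2
  refine h2.congr fun n => ?_
  simp [semiconj_linear_pow hh]

theorem eq_zero_of_semiconj_linear {c : ℂ} (h : ℂ ≃ₜ ℂ) (h0 : h 0 = 0)
    (hh : ∀ z, h (0 * z) = c * h z) : c = 0 := by
  simpa [h0] using (hh (h.symm 1)).symm

/-! ### Lifting homeomorphisms of the punctured plane through the exponential -/

theorem exists_exp_lift {f : ℂ → ℂ} (hf : Continuous f) (h0 : ∀ z, f z ≠ 0) :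
    ∃ F : ℂ → ℂ, Continuous F ∧ ∀ z, Complex.exp (F z) = f z := by
  let g : C(ℂ, {z : ℂ // z ≠ 0}) := ⟨fun z => ⟨f z, h0 z⟩, by fun_prop⟩
  obtain ⟨F, ⟨-, hF⟩, -⟩ := isCoveringMap_exp.existsUnique_continuousMap_lifts g 0 (log (f 0))
    (Subtype.ext (exp_log (h0 0)))
  exact ⟨F, F.continuous, fun z => congrArg Subtype.val (congrFun hF z)⟩

theorem eq_of_exp_comp_const {F : ℂ → ℂ} (hF : Continuous F) {u : ℂ}
    (h : ∀ z, Complex.exp (F z) = u) (z z' : ℂ) : F z = F z' :=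
  isCoveringMap_exp.const_of_comp hF (fun a b => Subtype.ext ((h a).trans (h b).symm)) z z'

/-- Two continuous maps whose exponentials have a constant ratio differ by a constant. -/
theorem exists_eq_add_of_exp_eq_mul {F G : ℂ → ℂ} (hF : Continuous F) (hG : Continuous G) {u : ℂ}
    (h : ∀ z, Complex.exp (F z) = u * Complex.exp (G z)) :
    ∃ β, Complex.exp β = u ∧ ∀ z, F z = G z + β := by
  have hu : ∀ z, Complex.exp (F z - G z) = u := fun z => by
    rw [exp_sub, h, mul_div_cancel_right₀ _ (exp_ne_zero _)]
  refine ⟨F 0 - G 0, hu 0, fun z => ?_⟩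
  linear_combination eq_of_exp_comp_const (F := fun z => F z - G z) (by fun_prop) hu z 0

/-- A lift through the exponential of a self-map of the punctured plane has an integer degree. -/
theorem exists_degree {h F : ℂ → ℂ} (hF : Continuous F)
    (hFh : ∀ z, Complex.exp (F z) = h (Complex.exp z)) :
    ∃ n : ℤ, ∀ z, F (z + 2 * Real.pi * I) = F z + n * (2 * Real.pi * I) := by
  obtain ⟨β, hβ, hadd⟩ := exists_eq_add_of_exp_eq_mul (F := fun z => F (z + 2 * Real.pi * I))
    (G := F) (u := 1) (by fun_prop) hF
    (fun z => by rw [hFh, hFh, exp_periodic z, one_mul])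
  obtain ⟨n, rfl⟩ := exp_eq_one_iff.mp hβ
  exact ⟨n, hadd⟩

theorem apply_add_int_mul_of_apply_add {F : ℂ → ℂ} {p q : ℂ} (h : ∀ z, F (z + p) = F z + q)
    (n : ℤ) (z : ℂ) : F (z + n * p) = F z + n * q := by
  induction n using Int.induction_on generalizing z with
  | zero => simp
  | succ i ih =>
    have := h (z + i * p)
    push_cast at ih ⊢
    rw [add_one_mul, ← add_assoc, this, ih]
    ring
  | pred i ih =>
    have := h (z + ((-i - 1 : ℤ) : ℂ) * p)
    have e : z + ((-i - 1 : ℤ) : ℂ) * p + p = z + ((-i : ℤ) : ℂ) * p := by push_cast; ring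
    rw [e, ih] at this
    push_cast at this ⊢
    linear_combination -this

/-- Lifts of mutually inverse maps of the punctured plane have mutually inverse degrees. -/
theorem degree_mul_eq_one {h k F G : ℂ → ℂ} (hF : Continuous F) (hG : Continuous G)
    (hFh : ∀ z, Complex.exp (F z) = h (Complex.exp z))
    (hGk : ∀ z, Complex.exp (G z) = k (Complex.exp z)) (hkh : ∀ z, k (h z) = z) {m n : ℤ}
    (hn : ∀ z, F (z + 2 * Real.pi * I) = F z + n * (2 * Real.pi * I))
    (hm : ∀ z, G (z + 2 * Real.pi * I) = G z + m * (2 * Real.pi * I)) : n * m = 1 := by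
  -- `G ∘ F` lifts the identity, so it is a translation; but it also has degree `n * m`.
  obtain ⟨β, -, hβ⟩ := exists_eq_add_of_exp_eq_mul (F := fun z => G (F z)) (G := fun z => z)
    (u := 1) (by fun_prop) continuous_id (fun z => by rw [hGk, hFh, hkh, one_mul])
  have h1 := hβ (0 + 2 * Real.pi * I)
  rw [hn, apply_add_int_mul_of_apply_add hm, hβ 0] at h1
  have h2 : ((n * m - 1 : ℤ) : ℂ) * (2 * Real.pi * I) = 0 := by
    push_cast
    linear_combination h1
  have h3 := (mul_eq_zero.mp h2).resolve_right two_pi_I_ne_zero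
  exact sub_eq_zero.mp (Int.cast_eq_zero.mp h3)

/-- A function that commutes with two real-proportional translations up to constants has the same
constants of proportionality, along the line they span. -/
theorem translation_constants_proportional {F : ℂ → ℂ} (hF : Continuous F) {p q r : ℂ} {x : ℝ}
    (hp : ∀ z, F (z + p) = F z + q) (hx : ∀ z, F (z + x * p) = F z + r) : r = x * q := by
  -- Removing the linear part leaves a 1-periodic, hence bounded, function; it would grow linearly
  -- along multiples of `x` if `r ≠ x * q`.
  let P : ℝ → ℂ := fun t => F (t * p) - t * q
  have hP : Continuous P := by fun_prop
  have hper : Function.Periodic P 1 := fun t => by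
    simp only [P]
    have := hp (t * p)
    rw [ofReal_add, ofReal_one, add_mul, one_mul, this]
    ring
  obtain ⟨C, hC⟩ := (hper.isBounded_of_continuous one_ne_zero hP).exists_norm_le
  have hk : ∀ k : ℕ, P (k * x) = P 0 + k * (r - x * q) := fun k => by
    have := apply_add_int_mul_of_apply_add hx k 0
    simp only [P]
    push_cast at this ⊢
    rw [zero_add, ← mul_assoc] at this
    rw [this]
    simp
    ring
  by_contra hne
  have hpos : 0 < ‖r - x * q‖ := norm_pos_iff.mpr (sub_ne_zero.mpr hne)
  obtain ⟨k, hkk⟩ := exists_nat_gt (2 * C / ‖r - x * q‖)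
  rw [div_lt_iff₀ hpos] at hkk
  have h1 : (k : ℂ) * (r - x * q) = P (k * x) - P 0 := by rw [hk]; ring
  have h2 : k * ‖r - x * q‖ ≤ C + C := by
    rw [← Complex.norm_natCast, ← norm_mul, h1]
    exact (norm_sub_le _ _).trans (add_le_add (hC _ ⟨_, rfl⟩) (hC _ ⟨_, rfl⟩))
  linarith

/-- Topologically conjugate rotations are equal or inverse to each other. -/
theorem eq_or_eq_inv_of_semiconj_rotation {a c : ℂ} (h : ℂ ≃ₜ ℂ) (h0 : h 0 = 0)
    (hh : ∀ z, h (a * z) = c * h z) (ha : ‖a‖ = 1) : c = a ∨ c = a⁻¹ := by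
  have h0' : h.symm 0 = 0 := h.injective (by simp [h0])
  obtain ⟨F, hF, hFh⟩ := exists_exp_lift (f := fun z => h (Complex.exp z))
    (h.continuous.comp Complex.continuous_exp)
    (fun z hz => exp_ne_zero z (h.injective (hz.trans h0.symm)))
  obtain ⟨G, hG, hGh⟩ := exists_exp_lift (f := fun z => h.symm (Complex.exp z))
    (h.symm.continuous.comp Complex.continuous_exp)
    (fun z hz => exp_ne_zero z (h.symm.injective (hz.trans h0'.symm)))
  obtain ⟨n, hn⟩ := exists_degree (h := h) hF hFh
  obtain ⟨m, hm⟩ := exists_degree (h := h.symm) hG hGh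
  have hnm := degree_mul_eq_one (h := h) (k := h.symm) hF hG hFh hGh h.symm_apply_apply hn hm
  have hpi : (Real.pi : ℂ) ≠ 0 := ofReal_ne_zero.mpr Real.pi_ne_zero
  have hax : Complex.exp (((a.arg / (2 * Real.pi) : ℝ) : ℂ) * (2 * Real.pi * I)) = a := by
    have := norm_mul_exp_arg_mul_I a
    rw [ha, ofReal_one, one_mul] at this
    rw [← this]
    congr 1
    rw [this]
    push_cast
    field_simp
  obtain ⟨β, hβ, hadd⟩ := exists_eq_add_of_exp_eq_mul (u := c) (G := F)
    (F := fun z => F (z + ((a.arg / (2 * Real.pi) : ℝ) : ℂ) * (2 * Real.pi * I)))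
    (by fun_prop) hF (fun z => by rw [hFh, hFh, Complex.exp_add, hax, mul_comm _ a, hh])
  have hprop := translation_constants_proportional hF hn hadd
  have hc : c = a ^ n := by
    rw [← hβ, hprop, ← hax, ← exp_int_mul, hax]
    congr 1
    ring
  rcases Int.eq_one_or_neg_one_of_mul_eq_one hnm with rfl | rfl
  · exact Or.inl (by simpa using hc)
  · exact Or.inr (by simpa using hc)

/-! ### Classification of linear maps and translations -/

/-- The multipliers of topologically conjugate linear maps of the plane. -/
theorem multipliers_of_topologicallyConjugate_linear {a c : ℂ} (hc1 : c ≠ 1)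
    (H : TopologicallyConjugate (fun z : ℂ => a * z) (fun z : ℂ => c * z)) :
    ((0 < ‖a‖ ∧ ‖a‖ < 1) ∧ (0 < ‖c‖ ∧ ‖c‖ < 1)) ∨ (1 < ‖a‖ ∧ 1 < ‖c‖) ∨ a = c ∨
      a = starRingEnd ℂ c := by
  obtain ⟨h, hh⟩ := H.exists_semiconj
  -- As `c ≠ 1`, the only fixed point of `z ↦ c * z` is 0.
  have h0 : h 0 = 0 := by
    have h1 := hh 0
    rw [mul_zero] at h1
    by_contra hne
    exact hc1 (mul_right_cancel₀ hne (by rw [one_mul, ← h1]))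
  have h0' : h.symm 0 = 0 := h.injective (by simp [h0])
  have hs : ∀ z, h.symm (c * z) = a * h.symm z := fun z => h.injective (by simp [hh])
  rcases eq_or_ne a 0 with rfl | ha
  · exact Or.inr (Or.inr (Or.inl (eq_zero_of_semiconj_linear h h0 hh).symm))
  rcases eq_or_ne c 0 with rfl | hc
  · exact absurd (eq_zero_of_semiconj_linear h.symm h0' hs) ha
  have inv_lt : ∀ {u : ℂ}, u ≠ 0 → (‖u⁻¹‖ < 1 ↔ 1 < ‖u‖) := fun hu => by
    rw [norm_inv, inv_lt_one₀ (norm_pos_iff.mpr hu)]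
  rcases lt_trichotomy ‖a‖ 1 with hlt | heq | hgt
  · exact Or.inl ⟨⟨norm_pos_iff.mpr ha, hlt⟩, norm_pos_iff.mpr hc,
      norm_lt_one_of_semiconj_linear h h0 hh hlt⟩
  · rcases eq_or_eq_inv_of_semiconj_rotation h h0 hh heq with rfl | rfl
    · exact Or.inr (Or.inr (Or.inl rfl))
    · refine Or.inr (Or.inr (Or.inr ?_))
      rw [inv_eq_conj heq, conj_conj]
  · exact Or.inr (Or.inl ⟨hgt, (inv_lt hc).mp (norm_lt_one_of_semiconj_linear h h0
      (semiconj_linear_inv ha hc hh) ((inv_lt ha).mpr hgt))⟩)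

theorem topologicallyConjugate_linear_of_multipliers {a c : ℂ}
    (H : ((0 < ‖a‖ ∧ ‖a‖ < 1) ∧ (0 < ‖c‖ ∧ ‖c‖ < 1)) ∨ (1 < ‖a‖ ∧ 1 < ‖c‖) ∨ a = c ∨
      a = starRingEnd ℂ c) :
    TopologicallyConjugate (fun z : ℂ => a * z) (fun z : ℂ => c * z) := by
  rcases H with ⟨⟨ha0, ha1⟩, hc0, hc1⟩ | ⟨ha, hc⟩ | rfl | rfl
  · exact topologicallyConjugate_linear_of_log_mul_pos
      (mul_pos_of_neg_of_neg (Real.log_neg ha0 ha1) (Real.log_neg hc0 hc1))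
  · exact topologicallyConjugate_linear_of_log_mul_pos
      (mul_pos (Real.log_pos ha) (Real.log_pos hc))
  · exact .refl _
  · exact .of_semiconj conjCLE.toHomeomorph fun z => by simp

theorem topologicallyConjugate_translations {b d : ℂ} (h : b = 0 ↔ d = 0) :
    TopologicallyConjugate (fun z : ℂ => 1 * z + b) (fun z : ℂ => 1 * z + d) := by
  rcases eq_or_ne b 0 with hb | hb
  · rw [hb, h.mp hb]
    exact .refl _
  · have hd : d ≠ 0 := fun hd => hb (h.mpr hd)
    refine .of_semiconj (Homeomorph.mulLeft₀ (d / b) (div_ne_zero hd hb)) fun z => ?_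
    simp only [Homeomorph.coe_mulLeft₀]
    field_simp

/-- The fixed points of conjugate maps correspond to each other. -/
theorem exists_fixedPoint_of_topologicallyConjugate {X : Type*} [TopologicalSpace X] {f g : X → X}
    (H : TopologicallyConjugate f g) (hf : ∃ x, f x = x) : ∃ x, g x = x := by
  obtain ⟨h, hh⟩ := H.exists_semiconj
  obtain ⟨x, hx⟩ := hf
  exact ⟨h x, by rw [← hh, hx]⟩

theorem eq_self_of_topologicallyConjugate {X : Type*} [TopologicalSpace X] {f g : X → X}
    (H : TopologicallyConjugate f g) (hf : ∀ x, f x = x) (x : X) : g x = x := by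
  obtain ⟨h, rfl⟩ := H
  simp [hf]

/-- An affine map conjugate to a translation is a translation, by zero only if both are. -/
theorem translation_of_topologicallyConjugate {b c d : ℂ}
    (H : TopologicallyConjugate (fun z : ℂ => 1 * z + b) (fun z : ℂ => c * z + d)) :
    c = 1 ∧ (b = 0 ↔ d = 0) := by
  rcases eq_or_ne b 0 with rfl | hb
  · have h := eq_self_of_topologicallyConjugate H (by simp)
    have hd : d = 0 := by simpa using h 0
    exact ⟨by simpa [hd] using h 1, by simp [hd]⟩
  · have h : ¬∃ z : ℂ, c * z + d = z := fun hz => by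
      obtain ⟨z, hz⟩ := exists_fixedPoint_of_topologicallyConjugate H.symm hz
      exact hb (by simpa using hz)
    have hc : c = 1 := by
      by_contra hc
      have h1 : 1 - c ≠ 0 := sub_ne_zero.mpr (Ne.symm hc)
      exact h ⟨d / (1 - c), by field_simp; ring⟩
    exact ⟨hc, iff_of_false hb fun hd => h ⟨0, by simp [hd]⟩⟩

theorem theorem4p2 (a b c d : ℂ) :
    TopologicallyConjugate (fun z : ℂ => a * z + b) (fun z : ℂ => c * z + d) ↔
      (((0 < ‖a‖ ∧ ‖a‖ < 1) ∧ (0 < ‖c‖ ∧ ‖c‖ < 1)) ∨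
        (1 < ‖a‖ ∧ 1 < ‖c‖) ∨
        a = c ∨
        a = starRingEnd ℂ c) ∧
      (a = 1 → c = 1 → (b = 0 ↔ d = 0)) := by
  constructor
  · intro H
    rcases eq_or_ne a 1 with rfl | ha
    · obtain ⟨rfl, h⟩ := translation_of_topologicallyConjugate H
      exact ⟨Or.inr (Or.inr (Or.inl rfl)), fun _ _ => h⟩
    · have hc : c ≠ 1 := by
        rintro rfl
        exact ha (translation_of_topologicallyConjugate H.symm).1
      exact ⟨multipliers_of_topologicallyConjugate_linear hc
        (((topologicallyConjugate_affine_linear ha b).symm.trans H).trans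
          (topologicallyConjugate_affine_linear hc d)), fun h => absurd h ha⟩
  · rintro ⟨H, h⟩
    -- The multiplier condition alone excludes that exactly one multiplier is 1.
    have hac : a = 1 ↔ c = 1 := by
      constructor
      · rintro rfl
        rcases H with ⟨⟨-, h1⟩, -⟩ | ⟨h1, -⟩ | h1 | h1
        · simp at h1
        · simp at h1
        · exact h1.symm
        · simpa using congrArg (starRingEnd ℂ) h1.symm
      · rintro rfl
        rcases H with ⟨-, -, h1⟩ | ⟨-, h1⟩ | h1 | h1
        · simp at h1
        · simp at h1
        · exact h1
        · simpa using h1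
    rcases eq_or_ne a 1 with ha | ha
    · have hc := hac.mp ha
      have hbd := h ha hc
      rw [ha, hc]
      exact topologicallyConjugate_translations hbd
    · have hc : c ≠ 1 := fun hc => ha (hac.mpr hc)
      exact ((topologicallyConjugate_affine_linear ha b).trans
        (topologicallyConjugate_linear_of_multipliers H)).trans
          (topologicallyConjugate_affine_linear hc d).symm
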